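/- For integers $0\le k\le n$ let $[n]=\{1,\dots,n\}$ and let $\binom{[n]}{k}$ be the collection of all $k$-element subsets of $[n]$. Call two families $\mathcal A,\mathcal B\subset\binom{[n]}{k}$ $s$-cross-intersecting if $|A\cap B|\ge s$ for all $A\in\mathcal A$ and $B\in\mathcal B$. Let $n,k,s$ be integers with $k>s\ge 1$ and $n>2k-s$, and put $\mathcal C=\{C\in\binom{[n]}{k}: |C\cap[k]|\ge s\}$. Then $$\max\bigl(|\mathcal A|+|\mathcal B|\bigr)=|\mathcal C|+1,$$ where the maximum is over all pairs of non-empty $s$-cross-intersecting families $\mathcal A,\mathcal B\subset\binom{[n]}{k}$. -/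

import Mathlib

/-- The collection of all `k`-element subsets of `[n] = {1, …, n}`. -/
def kSubsets (n k : ℕ) : Finset (Finset ℕ) :=
  Finset.powersetCard k (Finset.Icc 1 n)

/-- Two families are `s`-cross-intersecting if `|A ∩ B| ≥ s` for all members `A` of the first
and `B` of the second. -/
def CrossIntersecting (s : ℕ) (𝒜 ℬ : Finset (Finset ℕ)) : Prop :=
  ∀ A ∈ 𝒜, ∀ B ∈ ℬ, s ≤ (A ∩ B).card

/-- The family of all `k`-element subsets `C` of `[n]` with `|C ∩ [k]| ≥ s`. -/
def familyC (n k s : ℕ) : Finset (Finset ℕ) :=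
  (kSubsets n k).filter fun C => s ≤ (C ∩ Finset.Icc 1 k).card

/-!
Join two `k`-sets when they meet in fewer than `s` points. If `𝒜` and `ℬ` are cross-intersecting,
then `ℬ` avoids the neighbourhood `N(𝒜)`, so it suffices to show that the expansion
`|N(𝒜)| - |𝒜|` is smallest when `𝒜` is a singleton. A set minimising the expansion among the
nonempty `𝒜` whose neighbourhood is not everything is a *fragment*. By submodularity and the
duality `𝒜 ↦ N(𝒜)ᶜ`, distinct fragments of least cardinality are disjoint, and hence they are
blocks for the action of the symmetric group. A block containing two distinct `k`-sets that are
not complementary consists of all `k`-sets, and since `n > 2k - s` its neighbourhood is everything.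
This leaves only the blocks `{S}` and `{S, Sᶜ}`; the neighbourhood of the latter gains `S` itself,
so its expansion is no smaller.
-/

open Finset MulAction
open scoped Pointwise

section Fragments

variable {X : Type*} [Fintype X] {R : X → X → Prop} [DecidableRel R] {A B : Finset X}

variable (R) in
/-- The neighbourhood of a set `A` in the graph of a relation `R`. Members of `A` belong to it only
if they are related to a member of `A`. -/
def neighborhood (A : Finset X) : Finset X := {y | ∃ x ∈ A, R x y}

variable (R) in
/-- The amount by which the neighbourhood of `A` outnumbers `A`, as an integer since it may be
negative. -/
def expansion (A : Finset X) : ℤ := #(neighborhood R A) - #A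

variable (R) in
/-- The sets over which the expansion is minimised: those that are nonempty and whose
neighbourhood misses some point. -/
structure Separates (A : Finset X) : Prop where
  nonempty : A.Nonempty
  neighborhood_ne_univ : neighborhood R A ≠ univ

variable (R) in
/-- A fragment is a separating set of least expansion. -/
def IsFragment (A : Finset X) : Prop := MinimalFor (Separates R) (expansion R) A

variable (R) in
/-- An atomic fragment is a fragment of least cardinality. -/
def IsAtomicFragment (A : Finset X) : Prop := MinimalFor (IsFragment R) card A

theorem mem_neighborhood {y : X} : y ∈ neighborhood R A ↔ ∃ x ∈ A, R x y := by
  simp [neighborhood]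

theorem neighborhood_singleton (x : X) : neighborhood R {x} = univ.filter (R x) := by
  simp [neighborhood]

theorem neighborhood_mono (h : A ⊆ B) : neighborhood R A ⊆ neighborhood R B := by
  intro y hy
  obtain ⟨x, hx, hxy⟩ := mem_neighborhood.1 hy
  exact mem_neighborhood.2 ⟨x, h hx, hxy⟩

theorem Separates.mono (hB : Separates R B) (hA : A.Nonempty) (h : A ⊆ B) : Separates R A :=
  ⟨hA, fun hN => hB.neighborhood_ne_univ <| univ_subset_iff.1 <| hN ▸ neighborhood_mono h⟩

theorem exists_isAtomicFragment (hA : Separates R A) : ∃ B, IsAtomicFragment R B :=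
  exists_minimalFor_of_wellFoundedLT _ _ <|
    Set.Finite.exists_minimalFor (expansion R) {A | Separates R A} (Set.toFinite _) ⟨A, hA⟩

theorem disjoint_neighborhood_of_forall_not (h : ∀ a ∈ A, ∀ b ∈ B, ¬ R a b) :
    Disjoint (neighborhood R A) B := by
  rw [disjoint_left]
  intro b hbN hb
  obtain ⟨a, ha, hab⟩ := mem_neighborhood.1 hbN
  exact h a ha b hb hab

theorem Separates.of_forall_not (hA : A.Nonempty) (hB : B.Nonempty)
    (h : ∀ a ∈ A, ∀ b ∈ B, ¬ R a b) : Separates R A := by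
  obtain ⟨b, hb⟩ := hB
  refine ⟨hA, fun hN => ?_⟩
  exact disjoint_left.1 (disjoint_neighborhood_of_forall_not h) (hN ▸ mem_univ b) hb

theorem card_add_card_add_expansion_le (h : ∀ a ∈ A, ∀ b ∈ B, ¬ R a b) :
    #A + #B + expansion R A ≤ Fintype.card X := by
  have hle := card_le_univ (disjUnion _ _ (disjoint_neighborhood_of_forall_not h))
  rw [card_disjUnion] at hle
  simp only [expansion]
  omega

section DecidableEq

variable [DecidableEq X]

theorem neighborhood_union :
    neighborhood R (A ∪ B) = neighborhood R A ∪ neighborhood R B := by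
  ext y
  simp only [mem_union, mem_neighborhood, or_and_right, exists_or]

theorem expansion_union_add_expansion_inter_le :
    expansion R (A ∪ B) + expansion R (A ∩ B) ≤ expansion R A + expansion R B := by
  have hinter : #(neighborhood R (A ∩ B)) ≤ #(neighborhood R A ∩ neighborhood R B) :=
    card_le_card <| subset_inter (neighborhood_mono inter_subset_left)
      (neighborhood_mono inter_subset_right)
  have hN := card_union_add_card_inter (neighborhood R A) (neighborhood R B)
  have hAB := card_union_add_card_inter A B
  rw [← neighborhood_union] at hN
  simp only [expansion]
  omega

section Symmetric

variable [Std.Symm R]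

theorem neighborhood_compl_neighborhood_subset (A : Finset X) :
    neighborhood R (neighborhood R A)ᶜ ⊆ Aᶜ := by
  intro y hy
  obtain ⟨x, hx, hxy⟩ := mem_neighborhood.1 hy
  rw [mem_compl] at hx ⊢
  exact fun hyA => hx (mem_neighborhood.2 ⟨y, hyA, symm hxy⟩)

theorem Separates.compl_neighborhood (hA : Separates R A) : Separates R (neighborhood R A)ᶜ where
  nonempty := by
    simpa only [nonempty_iff_ne_empty, ne_eq, compl_eq_empty_iff] using hA.neighborhood_ne_univ
  neighborhood_ne_univ h := by
    have hcompl := neighborhood_compl_neighborhood_subset (R := R) A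
    rw [h, univ_subset_iff, compl_eq_univ_iff] at hcompl
    exact hA.nonempty.ne_empty hcompl

theorem expansion_compl_neighborhood_le (A : Finset X) :
    expansion R (neighborhood R A)ᶜ ≤ expansion R A := by
  have hcompl := card_le_card (neighborhood_compl_neighborhood_subset (R := R) A)
  have hA := card_add_card_compl A
  have hN := card_add_card_compl (neighborhood R A)
  simp only [expansion]
  omega

theorem IsFragment.compl_neighborhood (hA : IsFragment R A) :
    IsFragment R (neighborhood R A)ᶜ :=
  ⟨hA.prop.compl_neighborhood, fun _ hC _ =>
    (expansion_compl_neighborhood_le A).trans (hA.le hC)⟩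

theorem IsAtomicFragment.card_le_card_compl_neighborhood (hA : IsAtomicFragment R A) :
    #A ≤ #(neighborhood R A)ᶜ :=
  hA.le hA.prop.compl_neighborhood

theorem IsAtomicFragment.isFragment_inter (hA : IsAtomicFragment R A) (hB : IsAtomicFragment R B)
    (hAB : (A ∩ B).Nonempty) : IsFragment R (A ∩ B) := by
  have hsep : Separates R (A ∩ B) := hA.prop.prop.mono hAB inter_subset_left
  refine ⟨hsep, fun C hC _ => le_trans ?_ (hA.prop.le hC)⟩
  have hexp : expansion R A = expansion R B :=
    (hA.prop.le hB.prop.prop).antisymm (hB.prop.le hA.prop.prop)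
  have hsub := expansion_union_add_expansion_inter_le (R := R) (A := A) (B := B)
  by_cases hN : neighborhood R (A ∪ B) = univ
  · -- `A ∪ B` does not separate here, but `|A ∪ B| < 2|A| ≤ |A| + |N(A)ᶜ|` makes its expansion
    -- `|X| - |A ∪ B|` exceed that of `A`.
    have hcard : #A = #B := (hA.le hB.prop).antisymm (hB.le hA.prop)
    have hdual := hA.card_le_card_compl_neighborhood
    have hcompl := card_add_card_compl (neighborhood R A)
    have hui := card_union_add_card_inter A B
    have hunion : expansion R (A ∪ B) = Fintype.card X - #(A ∪ B) := by
      rw [expansion, hN, card_univ]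
    have hpos := hAB.card_pos
    simp only [expansion] at hunion hexp hsub ⊢
    omega
  · have hunion : expansion R A ≤ expansion R (A ∪ B) :=
      hA.prop.le ⟨hA.prop.prop.nonempty.mono subset_union_left, hN⟩
    linarith

theorem IsAtomicFragment.eq_of_inter_nonempty (hA : IsAtomicFragment R A)
    (hB : IsAtomicFragment R B) (hAB : (A ∩ B).Nonempty) : A = B := by
  have hfrag := hA.isFragment_inter hB hAB
  have hinterA := eq_of_subset_of_card_le inter_subset_left (hA.le hfrag)
  have hinterB := eq_of_subset_of_card_le inter_subset_right (hB.le hfrag)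
  exact hinterA.symm.trans hinterB

end Symmetric

section Action

variable {G : Type*} [Group G] [MulAction G X]

theorem neighborhood_smul (hG : ∀ (g : G) x y, R x y → R (g • x) (g • y)) (g : G)
    (A : Finset X) : neighborhood R (g • A) = g • neighborhood R A := by
  ext y
  simp only [mem_neighborhood, ← inv_smul_mem_iff]
  constructor
  · rintro ⟨x, hx, hxy⟩
    exact ⟨g⁻¹ • x, hx, hG _ _ _ hxy⟩
  · rintro ⟨x, hx, hxy⟩
    exact ⟨g • x, by rwa [inv_smul_smul], by simpa only [smul_inv_smul] using hG g _ _ hxy⟩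

theorem expansion_smul (hG : ∀ (g : G) x y, R x y → R (g • x) (g • y)) (g : G)
    (A : Finset X) : expansion R (g • A) = expansion R A := by
  rw [expansion, neighborhood_smul hG, card_smul_finset, card_smul_finset, expansion]

theorem Separates.smul (hG : ∀ (g : G) x y, R x y → R (g • x) (g • y)) (g : G)
    (hA : Separates R A) : Separates R (g • A) where
  nonempty := hA.nonempty.smul_finset
  neighborhood_ne_univ := by
    simpa only [neighborhood_smul hG, ne_eq, smul_eq_iff_eq_inv_smul, smul_finset_univ]
      using hA.neighborhood_ne_univ

theorem IsFragment.smul (hG : ∀ (g : G) x y, R x y → R (g • x) (g • y)) (g : G)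
    (hA : IsFragment R A) : IsFragment R (g • A) :=
  ⟨hA.prop.smul hG g, fun _ hC _ => (expansion_smul hG g A).trans_le (hA.le hC)⟩

theorem IsAtomicFragment.smul (hG : ∀ (g : G) x y, R x y → R (g • x) (g • y)) (g : G)
    (hA : IsAtomicFragment R A) : IsAtomicFragment R (g • A) :=
  ⟨hA.prop.smul hG g, fun _ hC _ => (card_smul_finset g A).trans_le (hA.le hC)⟩

end Action

end DecidableEq

section Blocks

variable {G : Type*} [Group G] [MulAction G X]

theorem IsAtomicFragment.isBlock [Std.Symm R] (hG : ∀ (g : G) x y, R x y → R (g • x) (g • y))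
    (hA : IsAtomicFragment R A) : IsBlock G (A : Set X) := by
  classical
  rw [isBlock_iff_smul_eq_of_nonempty]
  intro g hg
  rw [← coe_smul_finset, ← coe_inter, coe_nonempty] at hg
  rw [← coe_smul_finset, (hA.smul hG g).eq_of_inter_nonempty hA hg]

theorem le_expansion_of_forall_isBlock [Std.Symm R]
    (hG : ∀ (g : G) x y, R x y → R (g • x) (g • y)) {d : ℤ}
    (hd : ∀ B : Finset X, IsBlock G (B : Set X) → Separates R B → d ≤ expansion R B)
    (hA : Separates R A) : d ≤ expansion R A := by
  obtain ⟨B, hB⟩ := exists_isAtomicFragment hA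
  exact (hd B (hB.isBlock hG) hB.prop.prop).trans (hB.prop.le hA)

theorem expansion_singleton_eq [IsPretransitive G X]
    (hG : ∀ (g : G) x y, R x y → R (g • x) (g • y)) (x y : X) :
    expansion R {x} = expansion R {y} := by
  classical
  obtain ⟨g, rfl⟩ := exists_smul_eq G y x
  rw [← smul_finset_singleton, expansion_smul hG]

end Blocks

end Fragments

section PowersetCard

variable {α : Type*} [DecidableEq α] {k : ℕ}

theorem subgroup_eq_top_of_swap_mem [Finite α] {H : Subgroup (Equiv.Perm α)} {S : Set α}
    (hS : ∀ a b, (a ∈ S ↔ b ∈ S) → Equiv.swap a b ∈ H) {a b : α} (ha : a ∈ S) (hb : b ∉ S)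
    (hab : Equiv.swap a b ∈ H) : H = ⊤ := by
  have hswap_a : ∀ x, Equiv.swap x a ∈ H := by
    intro x
    by_cases hx : x ∈ S
    · exact hS x a (iff_of_true hx ha)
    · exact SubmonoidClass.swap_mem_trans H (hS x b (iff_of_false hx hb))
        (Equiv.swap_comm a b ▸ hab)
  rw [← top_le_iff, ← Equiv.Perm.closure_isSwap, Subgroup.closure_le]
  rintro _ ⟨x, y, -, rfl⟩
  exact SubmonoidClass.swap_mem_trans H (hswap_a x) (Equiv.swap_comm y a ▸ hswap_a y)

theorem swap_smul_powersetCard_eq {S : Set.powersetCard α k} {a b : α} (h : a ∈ S ↔ b ∈ S) :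
    Equiv.swap a b • S = S := by
  apply Subtype.ext
  rw [Set.powersetCard.coe_smul]
  ext x
  rw [← inv_smul_mem_iff, Equiv.swap_inv, Equiv.Perm.smul_def, Equiv.swap_apply_def]
  simp only [← Set.powersetCard.mem_coe_iff] at h
  grind

theorem swap_mem_stabilizer_of_isBlock {B : Set (Set.powersetCard α k)}
    (hB : IsBlock (Equiv.Perm α) B) {S : Set.powersetCard α k} (hS : S ∈ B) {a b : α}
    (h : a ∈ S ↔ b ∈ S) : Equiv.swap a b ∈ stabilizer (Equiv.Perm α) B :=
  hB.smul_eq_of_mem hS (by rwa [swap_smul_powersetCard_eq h])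

variable [Fintype α]

theorem exists_mem_notMem_mem_iff_mem {S T : Set.powersetCard α k} (hne : S ≠ T)
    (hcompl : (T : Finset α) ≠ (S : Finset α)ᶜ) : ∃ a ∈ S, ∃ b ∉ S, (a ∈ T ↔ b ∈ T) := by
  by_contra! hcon
  obtain ⟨a, haS, haT⟩ := (Set.powersetCard.exists_mem_notMem_iff_ne S T).1 hne
  obtain ⟨b, hbT, hbS⟩ := (Set.powersetCard.exists_mem_notMem_iff_ne T S).1 hne.symm
  refine hcompl (Finset.ext fun x => ?_)
  simp only [mem_compl, Set.powersetCard.mem_coe_iff]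
  grind

theorem eq_univ_of_isBlock_powersetCard {B : Set (Set.powersetCard α k)}
    (hB : IsBlock (Equiv.Perm α) B) {S T : Set.powersetCard α k} (hS : S ∈ B) (hT : T ∈ B)
    (hne : S ≠ T) (hcompl : (T : Finset α) ≠ (S : Finset α)ᶜ) : B = Set.univ := by
  obtain ⟨a, ha, b, hb, hab⟩ := exists_mem_notMem_mem_iff_mem hne hcompl
  have htop : stabilizer (Equiv.Perm α) B = ⊤ :=
    subgroup_eq_top_of_swap_mem (S := S) (fun _ _ => swap_mem_stabilizer_of_isBlock hB hS) ha hb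
      (swap_mem_stabilizer_of_isBlock hB hT hab)
  refine Set.eq_univ_of_forall fun U => ?_
  have := Set.powersetCard.isPretransitive (α := α) (n := k)
  obtain ⟨g, rfl⟩ := exists_smul_eq (Equiv.Perm α) S U
  have hg : g • B = B := mem_stabilizer_iff.1 (htop ▸ Subgroup.mem_top g)
  exact hg ▸ Set.smul_mem_smul_set hS

end PowersetCard

section Kneser

variable {α : Type*} [DecidableEq α] {k s : ℕ}

/-- Adjacency in the generalised Kneser graph on `k`-subsets: `S` and `T` are joined when they meet
in fewer than `s` points, that is, when they obstruct `s`-cross-intersection. -/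
def KneserAdj (s : ℕ) (S T : Set.powersetCard α k) : Prop := #((S : Finset α) ∩ T) < s

instance : DecidableRel (KneserAdj s : Set.powersetCard α k → Set.powersetCard α k → Prop) :=
  fun _ _ => Nat.decLt _ _

instance : Std.Symm (KneserAdj s : Set.powersetCard α k → Set.powersetCard α k → Prop) where
  symm S T h := by rwa [KneserAdj, inter_comm]

theorem KneserAdj.smul {G : Type*} [Group G] [MulAction G α] (g : G)
    (S T : Set.powersetCard α k) (h : KneserAdj s S T) : KneserAdj s (g • S) (g • T) := by
  rwa [KneserAdj, Set.powersetCard.coe_smul, Set.powersetCard.coe_smul, ← smul_finset_inter,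
    card_smul_finset]

variable [Fintype α]

theorem exists_kneserAdj (hs : 1 ≤ s) (hn : 2 * k < Fintype.card α + s)
    (S : Set.powersetCard α k) : ∃ T, KneserAdj s S T := by
  have hS := card_add_card_compl (S : Finset α)
  rw [Set.powersetCard.card_eq] at hS
  rcases le_total k #(S : Finset α)ᶜ with h | h
  · obtain ⟨T, hT, hTk⟩ := exists_subset_card_eq h
    refine ⟨⟨T, hTk⟩, ?_⟩
    have hdisj : Disjoint (S : Finset α) T := disjoint_compl_right.mono_right hT
    rw [KneserAdj, disjoint_iff_inter_eq_empty.1 hdisj, card_empty]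
    exact hs
  · obtain ⟨T, hT, hTk⟩ := exists_superset_card_eq h (by omega)
    refine ⟨⟨T, hTk⟩, ?_⟩
    have hinter : (S : Finset α) ∩ T = T \ (S : Finset α)ᶜ := by
      rw [sdiff_compl, inf_eq_inter, inter_comm]
    have hcard := card_sdiff_add_card_eq_card hT
    rw [KneserAdj, hinter]
    omega

theorem expansion_singleton_le_of_isBlock (hs : 1 ≤ s) (hsk : s ≤ k)
    (hn : 2 * k < Fintype.card α + s) {B : Finset (Set.powersetCard α k)}
    (hB : IsBlock (Equiv.Perm α) (B : Set (Set.powersetCard α k)))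
    (hsep : Separates (KneserAdj s) B) {S : Set.powersetCard α k} (hS : S ∈ B) :
    expansion (KneserAdj s) {S} ≤ expansion (KneserAdj s) B := by
  by_cases hsingle : ∀ T ∈ B, T = S
  · rw [eq_singleton_iff_unique_mem.2 ⟨hS, hsingle⟩]
  push Not at hsingle
  obtain ⟨T, hT, hTS⟩ := hsingle
  have hcompl : ∀ U ∈ B, U ≠ S → (U : Finset α) = (S : Finset α)ᶜ := by
    intro U hU hUS
    by_contra hc
    have huniv : B = univ := coe_eq_univ.1 (eq_univ_of_isBlock_powersetCard hB hS hU hUS.symm hc)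
    refine hsep.neighborhood_ne_univ (eq_univ_of_forall fun V => ?_)
    obtain ⟨W, hVW⟩ := exists_kneserAdj hs hn V
    exact mem_neighborhood.2 ⟨W, huniv ▸ mem_univ W, symm hVW⟩
  have hpair : B ⊆ {S, T} := fun U hU => by
    rw [mem_insert, mem_singleton, or_iff_not_imp_left]
    exact fun hUS => Subtype.ext ((hcompl U hU hUS).trans (hcompl T hT hTS).symm)
  have hST : S ∈ neighborhood (KneserAdj s) B := by
    refine mem_neighborhood.2 ⟨T, hT, ?_⟩
    rw [KneserAdj, hcompl T hT hTS, inter_comm, inter_compl, card_empty]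
    exact hs
  have hSS : S ∉ neighborhood (KneserAdj s) {S} := by
    simpa only [mem_neighborhood, mem_singleton, exists_eq_left, KneserAdj, inter_self,
      Set.powersetCard.card_eq, not_lt] using hsk
  have hlt : #(neighborhood (KneserAdj s) {S}) < #(neighborhood (KneserAdj s) B) :=
    card_lt_card <| ssubset_iff_of_subset
      (neighborhood_mono (singleton_subset_iff.2 hS)) |>.2 ⟨S, hST, hSS⟩
  have hcard : #B ≤ 2 := (card_le_card hpair).trans card_le_two
  rw [expansion, expansion, card_singleton]
  omega

theorem expansion_singleton_le (hs : 1 ≤ s) (hsk : s ≤ k) (hn : 2 * k < Fintype.card α + s)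
    {A : Finset (Set.powersetCard α k)} (hA : Separates (KneserAdj s) A)
    (S : Set.powersetCard α k) : expansion (KneserAdj s) {S} ≤ expansion (KneserAdj s) A := by
  refine le_expansion_of_forall_isBlock (G := Equiv.Perm α) KneserAdj.smul (fun B hB hsep => ?_) hA
  obtain ⟨T, hT⟩ := hsep.nonempty
  have := Set.powersetCard.isPretransitive (α := α) (n := k)
  rw [expansion_singleton_eq (G := Equiv.Perm α) KneserAdj.smul S T]
  exact expansion_singleton_le_of_isBlock hs hsk hn hB hsep hT

theorem card_add_card_le_of_forall_not_kneserAdj (hs : 1 ≤ s) (hsk : s ≤ k)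
    (hn : 2 * k < Fintype.card α + s) {A B : Finset (Set.powersetCard α k)} (hA : A.Nonempty)
    (hB : B.Nonempty) (hAB : ∀ S ∈ A, ∀ T ∈ B, ¬ KneserAdj s S T) (S : Set.powersetCard α k) :
    #A + #B ≤ #{T | ¬ KneserAdj s S T} + 1 := by
  have hle := card_add_card_add_expansion_le hAB
  have hexp := expansion_singleton_le hs hsk hn (.of_forall_not hA hB hAB) S
  have hsplit := card_filter_add_card_filter_not (s := univ) (KneserAdj s S)
  rw [expansion, neighborhood_singleton, card_singleton] at hexp
  rw [card_univ] at hsplit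
  omega

end Kneser

section GroundSet

variable {α : Type*} {X K : Finset α} {k s : ℕ} {𝒜 ℬ : Finset (Finset α)}

/-- The `k`-subsets of the subtype `X`, viewed as subsets of the ambient type. This transfers
results about the `k`-subsets of a finite type to those of a finite set. -/
def powersetCardEmbedding (X : Finset α) (k : ℕ) : Set.powersetCard X k ↪ Finset α :=
  (Function.Embedding.subtype _).trans (mapEmbedding (Function.Embedding.subtype _)).toEmbedding

theorem map_powersetCardEmbedding_univ (X : Finset α) (k : ℕ) :
    univ.map (powersetCardEmbedding X k) = powersetCard k X := by
  classical
  ext C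
  simp only [powersetCardEmbedding, mem_map, mem_univ, true_and, mem_powersetCard]
  constructor
  · rintro ⟨S, rfl⟩
    exact ⟨map_subtype_subset _, (card_map _).trans (Set.powersetCard.card_eq S)⟩
  · rintro ⟨hCX, hCk⟩
    have hC := subtype_map_of_mem hCX
    exact ⟨⟨C.subtype (· ∈ X), by rw [Set.powersetCard.mem_iff, ← hCk, ← card_map, hC]⟩, hC⟩

variable [DecidableEq α]

theorem kneserAdj_iff_powersetCardEmbedding (S T : Set.powersetCard X k) :
    KneserAdj s S T ↔ #(powersetCardEmbedding X k S ∩ powersetCardEmbedding X k T) < s := by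
  change _ ↔ #((S : Finset X).map _ ∩ (T : Finset X).map _) < s
  rw [← map_inter, card_map, KneserAdj]

theorem card_add_card_le_of_subset_powersetCard (hs : 1 ≤ s) (hsk : s ≤ k)
    (hn : 2 * k < #X + s) (hK : K ∈ powersetCard k X) (h𝒜 : 𝒜 ⊆ powersetCard k X)
    (hℬ : ℬ ⊆ powersetCard k X) (h𝒜₀ : 𝒜.Nonempty) (hℬ₀ : ℬ.Nonempty)
    (hAB : ∀ A ∈ 𝒜, ∀ B ∈ ℬ, s ≤ #(A ∩ B)) :
    #𝒜 + #ℬ ≤ #{C ∈ powersetCard k X | s ≤ #(C ∩ K)} + 1 := by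
  rw [← map_powersetCardEmbedding_univ] at hK h𝒜 hℬ ⊢
  obtain ⟨S, -, rfl⟩ := mem_map.1 hK
  obtain ⟨A, -, rfl⟩ := subset_map_iff.1 h𝒜
  obtain ⟨B, -, rfl⟩ := subset_map_iff.1 hℬ
  have hcross : ∀ S ∈ A, ∀ T ∈ B, ¬ KneserAdj s S T := fun S hS T hT => by
    rw [kneserAdj_iff_powersetCardEmbedding, not_lt]
    exact hAB _ (mem_map_of_mem _ hS) _ (mem_map_of_mem _ hT)
  have hle := card_add_card_le_of_forall_not_kneserAdj hs hsk (by rwa [Fintype.card_coe])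
    (map_nonempty.1 h𝒜₀) (map_nonempty.1 hℬ₀) hcross S
  simp only [kneserAdj_iff_powersetCardEmbedding, not_lt] at hle
  simpa only [card_map, filter_map, Function.comp_def, inter_comm] using hle

theorem theorem3_general (hs : 1 ≤ s) (hsk : s ≤ k) (hn : 2 * k < #X + s)
    (hK : K ∈ powersetCard k X) :
    IsGreatest
      {m : ℕ | ∃ 𝒜 ℬ : Finset (Finset α), 𝒜 ⊆ powersetCard k X ∧ ℬ ⊆ powersetCard k X ∧
        𝒜.Nonempty ∧ ℬ.Nonempty ∧ (∀ A ∈ 𝒜, ∀ B ∈ ℬ, s ≤ #(A ∩ B)) ∧ m = #𝒜 + #ℬ}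
      (#{C ∈ powersetCard k X | s ≤ #(C ∩ K)} + 1) := by
  constructor
  · have hKK : s ≤ #(K ∩ K) := by rwa [inter_self, (mem_powersetCard.1 hK).2]
    refine ⟨{K}, {C ∈ powersetCard k X | s ≤ #(C ∩ K)}, singleton_subset_iff.2 hK,
      filter_subset _ _, singleton_nonempty K, ⟨K, mem_filter.2 ⟨hK, hKK⟩⟩, ?_, ?_⟩
    · intro A hA B hB
      rw [mem_singleton.1 hA, inter_comm]
      exact (mem_filter.1 hB).2
    · rw [card_singleton, add_comm]
  · rintro m ⟨𝒜, ℬ, h𝒜, hℬ, h𝒜₀, hℬ₀, hAB, rfl⟩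
    exact card_add_card_le_of_subset_powersetCard hs hsk hn hK h𝒜 hℬ h𝒜₀ hℬ₀ hAB

end GroundSet

theorem theorem3 (n k s : ℕ) (hs : 1 ≤ s) (hsk : s < k) (hn : 2 * k < n + s) :
    IsGreatest
      {m : ℕ | ∃ 𝒜 ℬ : Finset (Finset ℕ), 𝒜 ⊆ kSubsets n k ∧ ℬ ⊆ kSubsets n k ∧
        𝒜.Nonempty ∧ ℬ.Nonempty ∧ CrossIntersecting s 𝒜 ℬ ∧ m = 𝒜.card + ℬ.card}
      ((familyC n k s).card + 1) :=
  theorem3_general hs hsk.le (by rwa [Nat.card_Icc, Nat.add_sub_cancel])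
    (mem_powersetCard.2 ⟨Icc_subset_Icc le_rfl (by omega), by simp⟩)
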